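/- Conventions. A (strict) $2$-category $\mathcal A$ is \emph{pre-2-filtered} if (F1) for all $f:E\to A$, $g:E\to B$ there are $u:A\to C$, $v:B\to C$ and an invertible $2$-cell $\gamma: uf\Rightarrow vg$; (F2) for all $2$-cells $\gamma_1:u_1f\Rightarrow v_1g$ and $\gamma_2:u_2f\Rightarrow v_2g$ (with $f:E\to A$, $g:E\to B$, $u_i:A\to C_i$, $v_i:B\to C_i$) there are $w_1:C_1\to C$, $w_2:C_2\to C$ and invertible $2$-cells $\alpha:w_1v_1\Rightarrow w_2v_2$, $\beta:w_1u_1\Rightarrow w_2u_2$ such that $(\alpha g)\circ(w_1\gamma_1)=(w_2\gamma_2)\circ(\beta f)$. Let $F:\mathcal A\to\mathcal Cat$ be a $2$-functor. A \emph{premorphism} $(x,A)\to(y,B)$, where $x\in FA$ and $y\in FB$, is a triple $(u,\xi,v)$ with $u:A\to C$, $v:B\to C$ and $\xi:F(u)(x)\to F(v)(y)$ in $FC$. A \emph{homotopy} $(u_1,\xi_1,v_1)\Rightarrow(u_2,\xi_2,v_2)$ is a quadruple $(w_1,w_2,\alpha,\beta)$ with $w_i:C_i\to C$ and invertible $2$-cells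 $\alpha:w_1v_1\Rightarrow w_2v_2$, $\beta:w_1u_1\Rightarrow w_2u_2$ such that $F(\alpha)_y\circ F(w_1)(\xi_1)=F(w_2)(\xi_2)\circ F(\beta)_x$. If $\mathcal A$ is pre-2-filtered, existence of a homotopy is an equivalence relation on premorphisms. The category $\mathcal L(F)$ has as objects the pairs $(x,A)$ with $x\in FA$, and as morphisms the equivalence classes $[u,\xi,v]$ of premorphisms; the composite of $[u,\xi,v]:(x,A)\to(y,B)$ and $[h,\zeta,k]:(y,B)\to(z,D)$ is $[su,\ F(t)(\zeta)\circ F(\gamma)_y\circ F(s)(\xi),\ tk]$ for any invertible $2$-cell $\gamma:sv\Rightarrow th$. A \emph{pseudocone} $h:F\Rightarrow\mathcal X$ with vertex a category $\mathcal X$ is a pseudonatural transformation from $F$ to the constant $2$-functor at $\mathcal X$: functors $h_A:FA\to\mathcal X$ and natural isomorphisms $h_u:h_B\circ F(u)\Rightarrow h_A$ for $u:A\to B$, with $h_{\mathrm{id}_A}=\mathrm{id}_{h_A}$, $h_{vu}=h_u\circ (h_vF(u))$, and $h_v\circ(h_BF(\gamma))=h_u$ for every $2$-cell $\gamma:u\Rightarrow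 v:A\to B$. A morphism $\varphi:h\to l$ of pseudocones is a modification: natural transformations $\varphi_A:h_A\Rightarrow l_A$ with $\varphi_A\circ h_u=l_u\circ(\varphi_BF(u))$ for every $u:A\to B$. They form a category $\mathcal{PC}[F,\mathcal X]$. Theorem. Let $\mathcal A$ be a pre-2-filtered $2$-category and $F:\mathcal A\to\mathcal Cat$ a $2$-functor. For $\xi:x\to y$ in $FA$ and $u:A\to B$ in $\mathcal A$, the formulas $$\lambda_A(x)=(x,A),\qquad \lambda_A(\xi)=[\mathrm{id}_A,\xi,\mathrm{id}_A],\qquad (\lambda_u)_x=[\mathrm{id}_B,\mathrm{id}_{F(u)(x)},u]:(F(u)(x),B)\to(x,A)$$ define a pseudocone $\lambda:F\Rightarrow\mathcal L(F)$. For every category $\mathcal X$, composition with $\lambda$, $$\mathcal Cat[\mathcal L(F),\mathcal X]\longrightarrow\mathcal{PC}[F,\mathcal X],\qquad s\longmapsto s\lambda,$$ is an equivalence of categories, and in fact an isomorphism of categories. In particular, for every pseudocone $h:F\Rightarrow\mathcal X$ there is a unique functor $\tilde h:\mathcal L(F)\to\mathcal X$ with $\tilde h\lambda=h$, and $\mathcal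 L(F)$ is the bicolimit of $F$. -/

import Mathlib

open CategoryTheory Bicategory

universe w₁ v₁ u₁ v₂ u₂ v₃ u₃ v₄ u₄

/-- A 2-category is pre-2-filtered when it satisfies the axioms
* F1: every span `A ⟵ E ⟶ A'` can be completed to a square commuting up to an invertible 2-cell;
* F2: any two 2-cells `γ₁ : f ≫ u₁ ⟶ g ≫ v₁` and `γ₂ : f ≫ u₂ ⟶ g ≫ v₂` over the same span
  `f, g` become equal after pasting with suitable invertible 2-cells `α` and `β`.

Composition is written in diagrammatic order, as everywhere in Mathlib. In a strict 2-category the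
associators `α_` are identities (given by equalities), and the equation says
`(g ◁ α) ∘ (γ₁ ▷ w₁) = (γ₂ ▷ w₂) ∘ (f ◁ β)`. No object is assumed to exist. -/
class IsPreTwoFiltered (B : Type u₁) [Bicategory.{w₁, v₁} B] : Prop where
  /-- Axiom F1. -/
  exists_square {E A A' : B} (f : E ⟶ A) (g : E ⟶ A') :
    ∃ (C : B) (u : A ⟶ C) (v : A' ⟶ C), Nonempty (f ≫ u ≅ g ≫ v)
  /-- Axiom F2. -/
  exists_ll {E A A' C₁ C₂ : B} (f : E ⟶ A) (g : E ⟶ A')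
      (u₁ : A ⟶ C₁) (v₁ : A' ⟶ C₁) (γ₁ : f ≫ u₁ ⟶ g ≫ v₁)
      (u₂ : A ⟶ C₂) (v₂ : A' ⟶ C₂) (γ₂ : f ≫ u₂ ⟶ g ≫ v₂) :
    ∃ (C : B) (w₁ : C₁ ⟶ C) (w₂ : C₂ ⟶ C) (α : v₁ ≫ w₁ ≅ v₂ ≫ w₂) (β : u₁ ≫ w₁ ≅ u₂ ≫ w₂),
      (α_ f u₁ w₁).inv ≫ γ₁ ▷ w₁ ≫ (α_ g v₁ w₁).hom ≫ g ◁ α.hom =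
        f ◁ β.hom ≫ (α_ f u₂ w₂).inv ≫ γ₂ ▷ w₂ ≫ (α_ g v₂ w₂).hom

namespace LL

/-! The definitions below are written for a pseudofunctor `F` with values in categories, so that
the identifications `F(id)(x) = x` and `F(w)(F(u)(x)) = F(wu)(x)` are the structure isomorphisms of
`F`. For a strict 2-functor (`StrictPseudofunctor`) these are given by equalities (`eqToIso`). -/

section

variable {B : Type u₁} [Bicategory.{w₁, v₁} B] (F : B ⥤ᵖ Cat.{v₂, u₂})

/-- The object `F(u)(x)`. -/
abbrev act {A C : B} (u : A ⟶ C) (x : F.obj A) : F.obj C :=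
  (F.map u).toFunctor.obj x

/-- The morphism `F(u)(ξ)`. -/
abbrev actMap {A C : B} (u : A ⟶ C) {x y : F.obj A} (ξ : x ⟶ y) : act F u x ⟶ act F u y :=
  (F.map u).toFunctor.map ξ

/-- The component `F(γ)x : F(u)(x) ⟶ F(v)(x)` of a 2-cell `γ : u ⟶ v`. -/
def cell {A C : B} {u v : A ⟶ C} (γ : u ⟶ v) (x : F.obj A) : act F u x ⟶ act F v x :=
  (F.map₂ γ).toNatTrans.app x

/-- The identification `F(id)(x) = x`. -/
abbrev actId {A : B} (x : F.obj A) : act F (𝟙 A) x ≅ x :=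
  (Cat.Hom.toNatIso (F.mapId A)).app x

/-- The identification `F(wu)(x) = F(w)(F(u)(x))`. -/
abbrev actComp {A C D : B} (u : A ⟶ C) (w : C ⟶ D) (x : F.obj A) :
    act F (u ≫ w) x ≅ act F w (act F u x) :=
  (Cat.Hom.toNatIso (F.mapComp u w)).app x

/-- The morphism `F(w)(ξ) : F(w)(F(u)(x)) ⟶ F(w)(F(v)(y))`, regarded as a morphism
`F(wu)(x) ⟶ F(wv)(y)`. -/
def push {A A' C D : B} {u : A ⟶ C} {v : A' ⟶ C} {x : F.obj A} {y : F.obj A'}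
    (ξ : act F u x ⟶ act F v y) (w : C ⟶ D) : act F (u ≫ w) x ⟶ act F (v ≫ w) y :=
  (actComp F u w x).hom ≫ actMap F w ξ ≫ (actComp F v w y).inv

section lemmas
variable {F}
variable {A A' A'' C D E : B} {x : F.obj A} {y : F.obj A'} {z : F.obj A''}

lemma cell_id (u : A ⟶ C) : cell F (𝟙 u) x = 𝟙 _ := by
  simp [cell]

lemma cell_comp {u v w : A ⟶ C} (γ : u ⟶ v) (δ : v ⟶ w) :
    cell F (γ ≫ δ) x = cell F γ x ≫ cell F δ x := by
  simp [cell]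

lemma push_comp {u : A ⟶ C} {v : A' ⟶ C} {k : A'' ⟶ C}
    (ξ : act F u x ⟶ act F v y) (ζ : act F v y ⟶ act F k z) (w : C ⟶ D) :
    push F (ξ ≫ ζ) w = push F ξ w ≫ push F ζ w := by
  simp [push, actMap]

lemma push_id {u : A ⟶ C} (w : C ⟶ D) : push F (𝟙 (act F u x)) w = 𝟙 _ := by
  simp [push, actMap]

lemma push_cell {u v : A ⟶ C} (γ : u ⟶ v) (w : C ⟶ D) :
    push F (cell F γ x) w = cell F (γ ▷ w) x := by
  simp [push, cell, actMap, act]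

lemma push_nat {u : A ⟶ C} {v : A' ⟶ C} (ξ : act F u x ⟶ act F v y) {w w' : C ⟶ D}
    (θ : w ⟶ w') : push F ξ w ≫ cell F (v ◁ θ) y = cell F (u ◁ θ) x ≫ push F ξ w' := by
  simp [push, cell, actMap, act]

lemma push_push {u : A ⟶ C} {v : A' ⟶ C} (ξ : act F u x ⟶ act F v y) (w : C ⟶ D) (w' : D ⟶ E) :
    push F (push F ξ w) w' ≫ cell F (α_ v w w').hom y =
      cell F (α_ u w w').hom x ≫ push F ξ (w ≫ w') := by
  have h₁ := (F.mapComp w w').inv.toNatTrans.naturality ξ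
  have h₂ : (F.map w').toFunctor.map ((F.mapComp v w).inv.toNatTrans.app y) ≫
      (F.map w').toFunctor.map ((F.mapComp v w).hom.toNatTrans.app y) = 𝟙 _ := by
    rw [← Functor.map_comp]; simp
  simp only [Cat.Hom.comp_toFunctor, Functor.comp_map] at h₁
  simp [push, cell, actMap, act]
  rw [reassoc_of% h₂, reassoc_of% h₁]

lemma push_unit {u : A ⟶ C} {v : A' ⟶ C} (ξ : act F u x ⟶ act F v y) :
    push F ξ (𝟙 C) ≫ cell F (ρ_ v).hom y = cell F (ρ_ u).hom x ≫ ξ := by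
  simp [push, cell, actMap, act]

/-- The square with horizontal sides `ξ`, `ξ'` and vertical sides `F(β)x`, `F(α)y` commutes. -/
def Sq {u u' : A ⟶ C} {v v' : A' ⟶ C} (ξ : act F u x ⟶ act F v y) (ξ' : act F u' x ⟶ act F v' y)
    (β : u ⟶ u') (α : v ⟶ v') : Prop :=
  ξ ≫ cell F α y = cell F β x ≫ ξ'

variable {u u' u'' : A ⟶ C} {v v' v'' : A' ⟶ C} {k k' : A'' ⟶ C} {ξ : act F u x ⟶ act F v y}
  {ξ' : act F u' x ⟶ act F v' y} {ξ'' : act F u'' x ⟶ act F v'' y}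
  {ζ : act F v y ⟶ act F k z} {ζ' : act F v' y ⟶ act F k' z}

lemma Sq.trans {β : u ⟶ u'} {α : v ⟶ v'} {β' : u' ⟶ u''} {α' : v' ⟶ v''} (h : Sq ξ ξ' β α)
    (h' : Sq ξ' ξ'' β' α') : Sq ξ ξ'' (β ≫ β') (α ≫ α') := by
  unfold Sq at *
  rw [cell_comp, cell_comp, reassoc_of% h, h', Category.assoc]

lemma Sq.symm {β : u ≅ u'} {α : v ≅ v'} (h : Sq ξ ξ' β.hom α.hom) : Sq ξ' ξ β.inv α.inv := by
  unfold Sq at *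
  calc ξ' ≫ cell F α.inv y = cell F (β.inv ≫ β.hom) x ≫ ξ' ≫ cell F α.inv y := by
        simp [cell_id]
    _ = cell F β.inv x ≫ ξ ≫ cell F (α.hom ≫ α.inv) y := by
        rw [cell_comp, cell_comp, Category.assoc, ← reassoc_of% h]
    _ = _ := by simp [cell_id]

lemma Sq.hcomp {β : u ⟶ u'} {α : v ⟶ v'} {δ : k ⟶ k'} (h : Sq ξ ξ' β α)
    (h' : Sq ζ ζ' α δ) : Sq (ξ ≫ ζ) (ξ' ≫ ζ') β δ := by
  unfold Sq at *
  rw [Category.assoc, h', reassoc_of% h]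

lemma Sq.push {β : u ⟶ u'} {α : v ⟶ v'} (h : Sq ξ ξ' β α) (w : C ⟶ D) :
    Sq (push F ξ w) (push F ξ' w) (β ▷ w) (α ▷ w) := by
  unfold Sq at *
  rw [← push_cell, ← push_cell, ← push_comp, ← push_comp, h]

lemma Sq.nat (ξ : act F u x ⟶ act F v y) {w w' : C ⟶ D} (θ : w ⟶ w') :
    Sq (LL.push F ξ w) (LL.push F ξ w') (u ◁ θ) (v ◁ θ) := push_nat ξ θ

lemma Sq.assoc (ξ : act F u x ⟶ act F v y) (w : C ⟶ D) (w' : D ⟶ E) :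
    Sq (LL.push F (LL.push F ξ w) w') (LL.push F ξ (w ≫ w')) (α_ u w w').hom (α_ v w w').hom :=
  push_push ξ w w'

lemma Sq.unit (ξ : act F u x ⟶ act F v y) :
    Sq (LL.push F ξ (𝟙 C)) ξ (ρ_ u).hom (ρ_ v).hom := push_unit ξ

lemma Sq.cell {u u' v v' : A ⟶ C} {γ : u ⟶ v} {γ' : u' ⟶ v'} {β : u ⟶ u'} {α : v ⟶ v'}
    (h : γ ≫ α = β ≫ γ') : Sq (LL.cell F γ x) (LL.cell F γ' x) β α := by
  unfold Sq
  rw [← cell_comp, ← cell_comp, h]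

lemma Sq.refl (ξ : act F u x ⟶ act F v y) : Sq ξ ξ (𝟙 u) (𝟙 v) := by
  simp [Sq, cell_id]

lemma Sq.id {u u' : A ⟶ C} (β : u ⟶ u') : Sq (𝟙 (act F u x)) (𝟙 (act F u' x)) β β := by
  simp [Sq]

end lemmas

/-- The type of objects of the category `L(F)`: pairs `(x, A)` with `x` an object of `F(A)`. -/
structure L where
  /-- The object `A`. -/
  base : B
  /-- The object `x` of `F(A)`. -/
  pt : F.obj base

variable {F}

/-- A premorphism `(x, A) ⟶ (y, A')` is a triple `(u, ξ, v)` with `u : A ⟶ C`, `v : A' ⟶ C` and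
`ξ : F(u)(x) ⟶ F(v)(y)` in `F(C)`. -/
structure Premorphism (X Y : L F) where
  {apex : B}
  u : X.base ⟶ apex
  v : Y.base ⟶ apex
  ξ : act F u X.pt ⟶ act F v Y.pt

/-- A homotopy `(u₁, ξ₁, v₁) ⇒ (u₂, ξ₂, v₂)` is a quadruple `(w₁, w₂, α, β)` with invertible 2-cells
`α : w₁ v₁ ≅ w₂ v₂` and `β : w₁ u₁ ≅ w₂ u₂` such that `F(α)y ∘ F(w₁)(ξ₁) = F(w₂)(ξ₂) ∘ F(β)x`. -/
structure Homotopy {X Y : L F} (p q : Premorphism X Y) where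
  {apex : B}
  w₁ : p.apex ⟶ apex
  w₂ : q.apex ⟶ apex
  α : p.v ≫ w₁ ≅ q.v ≫ w₂
  β : p.u ≫ w₁ ≅ q.u ≫ w₂
  ll : push F p.ξ w₁ ≫ cell F α.hom Y.pt = cell F β.hom X.pt ≫ push F q.ξ w₂

/-- Two premorphisms are equivalent when there is a homotopy from the first to the second. -/
def Homotopic {X Y : L F} (p q : Premorphism X Y) : Prop := Nonempty (Homotopy p q)

/-- The identity premorphism `(id, id, id)`. -/
def Premorphism.id (X : L F) : Premorphism X X := ⟨𝟙 X.base, 𝟙 X.base, 𝟙 _⟩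

/-- The composite `ζ ∘_γ ξ` of two premorphisms `(u, ξ, v)` and `(h, ζ, k)` over an invertible 2-cell
`γ : s v ≅ t h`: the triple with legs `s u`, `t k` and the morphism `F(t)(ζ) ∘ F(γ)y ∘ F(s)(ξ)`. -/
def Premorphism.compOver {X Y Z : L F} (p : Premorphism X Y) (q : Premorphism Y Z) {H : B}
    (s : p.apex ⟶ H) (t : q.apex ⟶ H) (γ : p.v ≫ s ≅ q.u ≫ t) : Premorphism X Z where
  u := p.u ≫ s
  v := q.v ≫ t
  ξ := push F p.ξ s ≫ cell F γ.hom Y.pt ≫ push F q.ξ t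

section lemmas

variable {X Y Z W : L F}

lemma Homotopic.symm {p q : Premorphism X Y} (h : Homotopic p q) : Homotopic q p := by
  obtain ⟨h⟩ := h
  exact ⟨⟨h.w₂, h.w₁, h.α.symm, h.β.symm, Sq.symm h.ll⟩⟩

lemma Homotopic.of_sq {C : B} {u u' : X.base ⟶ C} {v v' : Y.base ⟶ C}
    {ξ : act F u X.pt ⟶ act F v Y.pt} {ξ' : act F u' X.pt ⟶ act F v' Y.pt}
    (β : u ≅ u') (α : v ≅ v') (h : Sq ξ ξ' β.hom α.hom) :
    Homotopic (F := F) (X := X) (Y := Y) ⟨u, v, ξ⟩ ⟨u', v', ξ'⟩ :=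
  ⟨⟨𝟙 _, 𝟙 _, whiskerRightIso α _, whiskerRightIso β _, h.push _⟩⟩

lemma Homotopic.refl (p : Premorphism X Y) : Homotopic p p :=
  Homotopic.of_sq (Iso.refl _) (Iso.refl _) (Sq.refl p.ξ)

lemma Homotopic.of_push (p : Premorphism X Y) {D : B} (w : p.apex ⟶ D) :
    Homotopic p ⟨p.u ≫ w, p.v ≫ w, push F p.ξ w⟩ :=
  ⟨⟨w, 𝟙 _, (ρ_ _).symm, (ρ_ _).symm, Sq.symm (Sq.unit _)⟩⟩

variable [IsPreTwoFiltered B]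

lemma Homotopic.trans {p q r : Premorphism X Y} (h : Homotopic p q) (h' : Homotopic q r) :
    Homotopic p r := by
  obtain ⟨h⟩ := h
  obtain ⟨h'⟩ := h'
  obtain ⟨H, s, t, ⟨γ⟩⟩ := IsPreTwoFiltered.exists_square h.w₂ h'.w₁
  exact ⟨⟨h.w₁ ≫ s, h'.w₂ ≫ t,
    (α_ _ _ _).symm ≪≫ whiskerRightIso h.α s ≪≫ α_ _ _ _ ≪≫ whiskerLeftIso _ γ ≪≫
      (α_ _ _ _).symm ≪≫ whiskerRightIso h'.α t ≪≫ α_ _ _ _,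
    (α_ _ _ _).symm ≪≫ whiskerRightIso h.β s ≪≫ α_ _ _ _ ≪≫ whiskerLeftIso _ γ ≪≫
      (α_ _ _ _).symm ≪≫ whiskerRightIso h'.β t ≪≫ α_ _ _ _,
    (Sq.assoc _ _ _).symm.trans <| (Sq.push h.ll s).trans <| (Sq.assoc _ _ _).trans <|
      (Sq.nat _ _).trans <| (Sq.assoc _ _ _).symm.trans <| (Sq.push h'.ll t).trans <|
      Sq.assoc _ _ _⟩⟩

lemma compOver_indep (p : Premorphism X Y) (q : Premorphism Y Z) {H H' : B}
    (s : p.apex ⟶ H) (t : q.apex ⟶ H) (γ : p.v ≫ s ≅ q.u ≫ t)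
    (s' : p.apex ⟶ H') (t' : q.apex ⟶ H') (γ' : p.v ≫ s' ≅ q.u ≫ t') :
    Homotopic (p.compOver q s t γ) (p.compOver q s' t' γ') := by
  obtain ⟨C, w₁, w₂, α, β, h⟩ :=
    IsPreTwoFiltered.exists_ll p.v q.u s t γ.hom s' t' γ'.hom
  refine ⟨⟨w₁, w₂, α_ _ _ _ ≪≫ whiskerLeftIso _ α ≪≫ (α_ _ _ _).symm,
    α_ _ _ _ ≪≫ whiskerLeftIso _ β ≪≫ (α_ _ _ _).symm, ?_⟩⟩
  simp only [Premorphism.compOver, push_comp, push_cell]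
  refine Sq.hcomp (α := (α_ _ _ _ ≪≫ whiskerLeftIso _ β ≪≫ (α_ _ _ _).symm).hom)
    ((Sq.assoc _ _ _).trans <| (Sq.nat _ _).trans <| (Sq.assoc _ _ _).symm)
    (Sq.hcomp (α := (α_ _ _ _ ≪≫ whiskerLeftIso _ α ≪≫ (α_ _ _ _).symm).hom) (Sq.cell ?_)
    ((Sq.assoc _ _ _).trans <| (Sq.nat _ _).trans <| (Sq.assoc _ _ _).symm))
  have := h =≫ (α_ _ _ _).inv
  simp only [Category.assoc] at this
  simp [← cancel_epi (α_ p.v s w₁).inv, this]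

lemma Premorphism.exists_compOver (p : Premorphism X Y) (q : Premorphism Y Z) :
    ∃ (H : B) (s : p.apex ⟶ H) (t : q.apex ⟶ H), Nonempty (p.v ≫ s ≅ q.u ≫ t) :=
  IsPreTwoFiltered.exists_square _ _

lemma compOver_congr_left {p p' : Premorphism X Y} (h : Homotopic p p') (q : Premorphism Y Z)
    {H H' : B} (s : p.apex ⟶ H) (t : q.apex ⟶ H) (γ : p.v ≫ s ≅ q.u ≫ t)
    (s' : p'.apex ⟶ H') (t' : q.apex ⟶ H') (γ' : p'.v ≫ s' ≅ q.u ≫ t') :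
    Homotopic (p.compOver q s t γ) (p'.compOver q s' t' γ') := by
  obtain ⟨h⟩ := h
  obtain ⟨K, a, b, ⟨δ⟩⟩ := IsPreTwoFiltered.exists_square (p.v ≫ h.w₁) q.u
  refine (compOver_indep p q s t γ (h.w₁ ≫ a) b ((α_ _ _ _).symm ≪≫ δ)).trans
    (Homotopic.trans ?_ (compOver_indep p' q (h.w₂ ≫ a) b
      ((α_ _ _ _).symm ≪≫ whiskerRightIso h.α.symm a ≪≫ δ) s' t' γ'))
  refine Homotopic.of_sq ((α_ _ _ _).symm ≪≫ whiskerRightIso h.β a ≪≫ α_ _ _ _) (Iso.refl _)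
    (Sq.hcomp (α := ((α_ _ _ _).symm ≪≫ whiskerRightIso h.α a ≪≫ α_ _ _ _).hom)
    ((Sq.assoc _ _ _).symm.trans <| (Sq.push h.ll a).trans <| Sq.assoc _ _ _)
    (Sq.hcomp (α := 𝟙 _) (Sq.cell (by simp)) (Sq.refl _)))

lemma compOver_congr_right (p : Premorphism X Y) {q q' : Premorphism Y Z} (h : Homotopic q q')
    {H H' : B} (s : p.apex ⟶ H) (t : q.apex ⟶ H) (γ : p.v ≫ s ≅ q.u ≫ t)
    (s' : p.apex ⟶ H') (t' : q'.apex ⟶ H') (γ' : p.v ≫ s' ≅ q'.u ≫ t') :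
    Homotopic (p.compOver q s t γ) (p.compOver q' s' t' γ') := by
  obtain ⟨h⟩ := h
  obtain ⟨K, a, b, ⟨δ⟩⟩ := IsPreTwoFiltered.exists_square p.v (q.u ≫ h.w₁)
  refine (compOver_indep p q s t γ a (h.w₁ ≫ b) (δ ≪≫ α_ _ _ _)).trans
    (Homotopic.trans ?_ (compOver_indep p q' a (h.w₂ ≫ b)
      (δ ≪≫ whiskerRightIso h.β b ≪≫ α_ _ _ _) s' t' γ'))
  refine Homotopic.of_sq (Iso.refl _) ((α_ _ _ _).symm ≪≫ whiskerRightIso h.α b ≪≫ α_ _ _ _)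
    (Sq.hcomp (α := 𝟙 _) (Sq.refl _)
    (Sq.hcomp (α := ((α_ _ _ _).symm ≪≫ whiskerRightIso h.β b ≪≫ α_ _ _ _).hom)
    (Sq.cell (by simp))
    ((Sq.assoc _ _ _).symm.trans <| (Sq.push h.ll b).trans <| Sq.assoc _ _ _)))

lemma compOver_congr {p p' : Premorphism X Y} (h : Homotopic p p') {q q' : Premorphism Y Z}
    (h' : Homotopic q q')
    {H H' : B} (s : p.apex ⟶ H) (t : q.apex ⟶ H) (γ : p.v ≫ s ≅ q.u ≫ t)
    (s' : p'.apex ⟶ H') (t' : q'.apex ⟶ H') (γ' : p'.v ≫ s' ≅ q'.u ≫ t') :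
    Homotopic (p.compOver q s t γ) (p'.compOver q' s' t' γ') := by
  obtain ⟨K, a, b, ⟨δ⟩⟩ := p'.exists_compOver q
  exact (compOver_congr_left h q s t γ a b δ).trans (compOver_congr_right p' h' a b δ s' t' γ')

end lemmas

section category

variable [IsPreTwoFiltered B]

/-- Equivalence of premorphisms is an equivalence relation. -/
instance Premorphism.setoid (X Y : L F) : Setoid (Premorphism X Y) where
  r := Homotopic
  iseqv := ⟨Homotopic.refl, Homotopic.symm, Homotopic.trans⟩

/-- A composite of two premorphisms, over some chosen invertible 2-cell. -/
noncomputable def Premorphism.comp {X Y Z : L F} (p : Premorphism X Y) (q : Premorphism Y Z) :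
    Premorphism X Z :=
  p.compOver q _ _ (p.exists_compOver q).choose_spec.choose_spec.choose_spec.some

lemma id_comp_homotopic {X Y : L F} (p : Premorphism X Y) :
    Homotopic ((Premorphism.id X).comp p) p := by
  refine (compOver_indep _ p _ _ _ p.u (𝟙 _) (λ_ _ ≪≫ (ρ_ _).symm)).trans ?_
  refine Homotopic.of_sq (λ_ _) (ρ_ _) ?_
  simp only [Premorphism.id, push_id, Category.id_comp]
  have := Sq.hcomp (Sq.cell (F := F) (x := X.pt) (γ' := 𝟙 _)
    (show ((λ_ p.u).hom ≫ (ρ_ p.u).inv) ≫ (ρ_ p.u).hom = (λ_ p.u).hom ≫ 𝟙 _ by simp))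
    (Sq.unit p.ξ)
  simpa [cell_id] using this

lemma comp_id_homotopic {X Y : L F} (p : Premorphism X Y) :
    Homotopic (p.comp (Premorphism.id Y)) p := by
  refine (compOver_indep p _ _ _ _ (𝟙 _) p.v (ρ_ _ ≪≫ (λ_ _).symm)).trans ?_
  refine Homotopic.of_sq (ρ_ _) (λ_ _) ?_
  simp only [Premorphism.id, push_id, Category.comp_id]
  have := Sq.hcomp (Sq.unit p.ξ) (Sq.cell (F := F) (x := Y.pt) (γ' := 𝟙 _)
    (show ((ρ_ p.v).hom ≫ (λ_ p.v).inv) ≫ (λ_ p.v).hom = (ρ_ p.v).hom ≫ 𝟙 _ by simp))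
  simpa [cell_id] using this

lemma comp_assoc_homotopic {X Y Z W : L F} (p : Premorphism X Y) (q : Premorphism Y Z)
    (r : Premorphism Z W) : Homotopic ((p.comp q).comp r) (p.comp (q.comp r)) := by
  obtain ⟨H, s, t, ⟨γ⟩⟩ := p.exists_compOver q
  obtain ⟨K, t', r', ⟨δ⟩⟩ := q.exists_compOver r
  obtain ⟨J, a, b, ⟨η⟩⟩ := IsPreTwoFiltered.exists_square t t'
  refine (compOver_congr (compOver_indep p q _ _ _ s t γ) (Homotopic.refl r) _ _ _ a (r' ≫ b)
    (α_ _ _ _ ≪≫ whiskerLeftIso _ η ≪≫ (α_ _ _ _).symm ≪≫ whiskerRightIso δ b ≪≫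
      α_ _ _ _)).trans (Homotopic.trans ?_ (compOver_congr (Homotopic.refl p)
      (compOver_indep q r t' r' δ _ _ _) (s ≫ a) b
      ((α_ _ _ _).symm ≪≫ whiskerRightIso γ a ≪≫ α_ _ _ _ ≪≫ whiskerLeftIso _ η ≪≫
        (α_ _ _ _).symm) _ _ _))
  refine Homotopic.of_sq (α_ _ _ _) (α_ _ _ _).symm ?_
  simp only [Premorphism.compOver, push_comp, push_cell, Category.assoc]
  refine Sq.hcomp (Sq.assoc _ _ _) ?_
  refine Sq.hcomp (α := (α_ _ _ _ ≪≫ whiskerLeftIso _ η ≪≫ (α_ _ _ _).symm).hom)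
    (Sq.cell (by simp)) ?_
  refine Sq.hcomp (α := (α_ _ _ _ ≪≫ whiskerLeftIso _ η ≪≫ (α_ _ _ _).symm).hom)
    ((Sq.assoc _ _ _).trans <| (Sq.nat _ _).trans <| (Sq.assoc _ _ _).symm) ?_
  exact Sq.hcomp (α := (α_ _ _ _).inv) (Sq.cell (by simp)) (Sq.assoc _ _ _).symm

/-- The category `L(F)`: morphisms are equivalence classes of premorphisms, and they are composed by
composing representatives. -/
noncomputable instance : Category (L F) where
  Hom X Y := Quotient (Premorphism.setoid X Y)
  id X := ⟦Premorphism.id X⟧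
  comp := Quotient.map₂ Premorphism.comp
    fun _ _ h _ _ h' => compOver_congr h h' _ _ _ _ _ _
  id_comp := by rintro X Y ⟨p⟩; exact Quotient.sound (id_comp_homotopic p)
  comp_id := by rintro X Y ⟨p⟩; exact Quotient.sound (comp_id_homotopic p)
  assoc := by
    rintro X Y Z W ⟨p⟩ ⟨q⟩ ⟨r⟩; exact Quotient.sound (comp_assoc_homotopic p q r)

/-- The morphism of `L(F)` represented by a premorphism. -/
def L.homMk {X Y : L F} (p : Premorphism X Y) : X ⟶ Y :=
  Quotient.mk (Premorphism.setoid X Y) p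

lemma L.homMk_eq_iff {X Y : L F} (p q : Premorphism X Y) :
    L.homMk p = L.homMk q ↔ Homotopic p q :=
  Quotient.eq (r := Premorphism.setoid X Y)

/-- The composite in `L(F)` does not depend on the invertible 2-cell used. -/
lemma L.homMk_comp_homMk {X Y Z : L F} (p : Premorphism X Y) (q : Premorphism Y Z) {H : B}
    (s : p.apex ⟶ H) (t : q.apex ⟶ H) (γ : p.v ≫ s ≅ q.u ≫ t) :
    L.homMk p ≫ L.homMk q = L.homMk (p.compOver q s t γ) :=
  Quotient.sound (s := Premorphism.setoid X Z) (compOver_indep p q _ _ _ s t γ)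

end category

variable (F)

/-- A pseudocone for `F` with vertex the category `𝒳` (a pseudonatural transformation from `F` to the
constant 2-functor at `𝒳`): functors `h_A : F(A) ⥤ 𝒳` and invertible natural transformations
`h_u : h_C ∘ F(u) ⟶ h_A` for `u : A ⟶ C`, subject to PC0, PC1 and PC2. -/
structure Pseudocone (𝒳 : Type u₃) [Category.{v₃} 𝒳] where
  /-- The functors `h_A`. -/
  app (A : B) : F.obj A ⥤ 𝒳
  /-- The invertible natural transformations `h_u`. -/
  trans {A C : B} (u : A ⟶ C) : (F.map u).toFunctor ⋙ app C ≅ app A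
  /-- PC0: `h_id = id`. -/
  trans_id {A : B} (x : F.obj A) : (trans (𝟙 A)).hom.app x = (app A).map (actId F x).hom
  /-- PC1: `h_{vu} = h_u ∘ h_v F(u)`. -/
  trans_comp {A C D : B} (u : A ⟶ C) (v : C ⟶ D) (x : F.obj A) :
    (trans (u ≫ v)).hom.app x =
      (app D).map (actComp F u v x).hom ≫ (trans v).hom.app (act F u x) ≫ (trans u).hom.app x
  /-- PC2: `h_v ∘ h_C F(γ) = h_u` for a 2-cell `γ : u ⟶ v`. -/
  trans_cell {A C : B} {u v : A ⟶ C} (γ : u ⟶ v) (x : F.obj A) :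
    (app C).map (cell F γ x) ≫ (trans v).hom.app x = (trans u).hom.app x

variable {F}

namespace Pseudocone

/-- A morphism of pseudocones with the same vertex (a modification): natural transformations
`φ_A : h_A ⟶ l_A` subject to PCM. -/
structure Hom {𝒳 : Type u₃} [Category.{v₃} 𝒳] (h l : Pseudocone F 𝒳) where
  /-- The natural transformations `φ_A`. -/
  app (A : B) : h.app A ⟶ l.app A
  /-- PCM: `φ_A ∘ h_u = l_u ∘ φ_C F(u)`. -/
  naturality {A C : B} (u : A ⟶ C) (x : F.obj A) :
    (h.trans u).hom.app x ≫ (app A).app x = (app C).app (act F u x) ≫ (l.trans u).hom.app x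

/-- The category `PC[F, 𝒳]` of pseudocones with vertex `𝒳`. -/
instance {𝒳 : Type u₃} [Category.{v₃} 𝒳] : Category (Pseudocone F 𝒳) where
  Hom := Hom
  id h := { app := fun A => 𝟙 (h.app A), naturality := by intros; simp }
  comp φ ψ :=
    { app := fun A => φ.app A ≫ ψ.app A
      naturality := fun u x => by
        simp only [NatTrans.comp_app, Category.assoc]
        rw [← ψ.naturality, ← Category.assoc, φ.naturality, Category.assoc] }
  id_comp φ := by cases φ; simp
  comp_id φ := by cases φ; simp
  assoc φ ψ χ := by simp

/-- Composition with a pseudocone `h` with vertex `𝒵`: the functor `Cat[𝒵, 𝒳] ⥤ PC[F, 𝒳]` that sends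
`s` to `s h = (s ∘ h_A, s h_u)` and a natural transformation `σ` to `(σ h_A)`. -/
def postcomp {𝒵 : Type u₄} [Category.{v₄} 𝒵] (h : Pseudocone F 𝒵)
    (𝒳 : Type u₃) [Category.{v₃} 𝒳] : (𝒵 ⥤ 𝒳) ⥤ Pseudocone F 𝒳 where
  obj s :=
    { app := fun A => h.app A ⋙ s
      trans := fun {A C} u => NatIso.ofComponents (fun x => s.mapIso ((h.trans u).app x))
        (fun f => by
          have := (h.trans u).hom.naturality f
          simp only [Functor.comp_map] at this
          simp [← Functor.map_comp, this])
      trans_id := fun x => by simp [h.trans_id]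
      trans_comp := fun u v x => by simp [h.trans_comp]
      trans_cell := fun γ x => by
        simp only [Functor.comp_map, NatIso.ofComponents_hom_app, Functor.mapIso_hom, Iso.app_hom,
          ← Functor.map_comp, h.trans_cell] }
  map σ :=
    { app := fun A => Functor.whiskerLeft (h.app A) σ
      naturality := fun u x => by simp }
  map_id s := rfl
  map_comp σ τ := rfl

end Pseudocone

end

/-- A functor is an isomorphism of categories when it has a strict two-sided inverse functor. -/
def IsIsoOfCategories {C : Type u₃} [Category.{v₃} C] {D : Type u₄} [Category.{v₄} D]
    (Φ : C ⥤ D) : Prop :=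
  ∃ Ψ : D ⥤ C, Φ ⋙ Ψ = 𝟭 C ∧ Ψ ⋙ Φ = 𝟭 D

end LL

namespace LL

/-! ### Coherence of the unit and composition constraints of `F` -/

section

variable {B : Type u₁} [Bicategory.{w₁, v₁} B] {F : B ⥤ᵖ Cat.{v₂, u₂}}

/-! Every morphism of `L(F)` is generated by the image of the pseudocone: `[u, ξ, v]` is `λ_v ∘
λ_C(ξ) ∘ λ_u⁻¹` (`L.homMk_factor`). Hence a functor out of `L(F)` is determined by its composite
with `λ`, and naturality of a family indexed by the objects of `L(F)` need only be checked on the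
morphisms `λ_C(ξ)` and `λ_u`, which is what a modification provides.

Conversely, a pseudocone `h` must send `[u, ξ, v]` to `h_v ∘ h_C(ξ) ∘ h_u⁻¹`. This value
(`Pseudocone.val`) is unchanged when a premorphism is pushed along a 1-cell, by PC1, and when its
legs are changed along 2-cells, by PC2. It is therefore constant on homotopy classes
(`val_eq_of_homotopic`) and multiplicative, which gives the functor `desc`. So composition with `λ`
is bijective on objects and fully faithful, hence an isomorphism of categories.

That `λ` is itself a pseudocone is a computation with representatives at a common apex. The delicate
axiom is PC2 for a 2-cell that is not invertible: homotopies contain only invertible 2-cells, and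
axiom F2 supplies the missing ones (`L.homMk_actId_cell`). -/

lemma actMap_id_naturality {A : B} {x y : F.obj A} (ξ : x ⟶ y) :
    actMap F (𝟙 A) ξ ≫ (actId F y).hom = (actId F x).hom ≫ ξ :=
  (Cat.Hom.toNatIso (F.mapId A)).hom.naturality ξ

/-- Naturality of the unit constraint at its own component, with the invertible component at `x`
cancelled. It yields PC0 for `λ`. -/
lemma actMap_actId {A : B} (x : F.obj A) :
    actMap F (𝟙 A) (actId F x).hom = (actId F (act F (𝟙 A) x)).hom := by
  rw [← cancel_mono (actId F x).hom]
  exact actMap_id_naturality _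

lemma Sq.leftUnitor {A C : B} {x y : F.obj A} (ξ : x ⟶ y) (u : A ⟶ C) :
    Sq (LL.push F (actMap F (𝟙 A) ξ) u) (actMap F u ξ) (λ_ u).hom (λ_ u).hom := by
  have := (F.map u).toFunctor.congr_map (actMap_id_naturality ξ)
  simp only [Functor.map_comp] at this
  simp [Sq, LL.push, LL.cell, actMap, act] at this ⊢
  rw [this]

lemma Sq.actId_push {A C D : B} (x : F.obj A) (u : A ⟶ C) (v : C ⟶ D) :
    Sq (LL.push F (actId F (act F u x)).hom v) (actComp F u v x).inv (λ_ v).hom (𝟙 (u ≫ v)) := by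
  simp [Sq, LL.push, LL.cell, actMap, act]

variable [IsPreTwoFiltered B]

/-! ### Calculus of representatives in `L(F)` -/

lemma L.homMk_eq_of_sq {X Y : L F} {C : B} {u u' : X.base ⟶ C} {v v' : Y.base ⟶ C}
    {ξ : act F u X.pt ⟶ act F v Y.pt} {ξ' : act F u' X.pt ⟶ act F v' Y.pt}
    (β : u ≅ u') (α : v ≅ v') (h : Sq ξ ξ' β.hom α.hom) :
    L.homMk (⟨u, v, ξ⟩ : Premorphism X Y) = L.homMk ⟨u', v', ξ'⟩ :=
  (L.homMk_eq_iff _ _).2 (Homotopic.of_sq β α h)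

lemma L.homMk_push {X Y : L F} {C D : B} {u : X.base ⟶ C} {v : Y.base ⟶ C}
    (ξ : act F u X.pt ⟶ act F v Y.pt) (w : C ⟶ D) :
    L.homMk (⟨u, v, ξ⟩ : Premorphism X Y) = L.homMk ⟨u ≫ w, v ≫ w, push F ξ w⟩ :=
  (L.homMk_eq_iff _ _).2 (Homotopic.of_push ⟨u, v, ξ⟩ w)

/-- Premorphisms with a common apex and a common leg are composed in `F` of the apex. -/
lemma L.homMk_comp_of_apex {X Y Z : L F} {C : B} {u : X.base ⟶ C} {v : Y.base ⟶ C}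
    {k : Z.base ⟶ C} (ξ : act F u X.pt ⟶ act F v Y.pt) (ζ : act F v Y.pt ⟶ act F k Z.pt) :
    L.homMk (⟨u, v, ξ⟩ : Premorphism X Y) ≫ L.homMk (⟨v, k, ζ⟩ : Premorphism Y Z) =
      L.homMk ⟨u, k, ξ ≫ ζ⟩ := by
  rw [L.homMk_comp_homMk _ _ (𝟙 C) (𝟙 C) (Iso.refl _)]
  refine L.homMk_eq_of_sq (ρ_ u) (ρ_ k) ?_
  have := Sq.unit (ξ ≫ ζ)
  rw [push_comp] at this
  simpa [cell_id] using this

/-- Up to unitors, this premorphism is the identity premorphism pushed along `u`. -/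
lemma L.homMk_id {X : L F} {C : B} (u : X.base ⟶ C) :
    L.homMk (⟨u, u, 𝟙 _⟩ : Premorphism X X) = 𝟙 X := by
  refine Eq.trans ?_ (L.homMk_push (X := X) (Y := X) (𝟙 (act F (𝟙 X.base) X.pt)) u).symm
  rw [push_id]
  exact L.homMk_eq_of_sq (λ_ u).symm (λ_ u).symm (Sq.id _)

/-- Moves `λ_A(ξ)` to the apex of `u`, where it can be composed with `λ_u` inside `F(C)`; this gives
naturality of `λ_u`. -/
lemma L.homMk_actMap {A C : B} {x y : F.obj A} (ξ : x ⟶ y) (u : A ⟶ C) :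
    L.homMk (⟨𝟙 A, 𝟙 A, actMap F (𝟙 A) ξ⟩ : Premorphism (⟨A, x⟩ : L F) ⟨A, y⟩) =
      L.homMk ⟨u, u, actMap F u ξ⟩ :=
  (L.homMk_push _ u).trans (L.homMk_eq_of_sq (λ_ u) (λ_ u) (Sq.leftUnitor ξ u))

/-- Moves `λ_u` to the apex of `v`, so that its composite with `λ_v` is computed inside `F(D)`; this
gives PC1. -/
lemma L.homMk_actId {A C D : B} (x : F.obj A) (u : A ⟶ C) (v : C ⟶ D) :
    L.homMk (⟨𝟙 C, u, (actId F (act F u x)).hom⟩ :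
        Premorphism (⟨C, act F u x⟩ : L F) ⟨A, x⟩) =
      L.homMk ⟨v, u ≫ v, (actComp F u v x).inv⟩ :=
  (L.homMk_push _ v).trans (L.homMk_eq_of_sq (λ_ v) (Iso.refl _) (Sq.actId_push x u v))

/-- The morphism represented by a 2-cell `γ`, which need not be invertible, is that represented by
an identity. -/
lemma L.homMk_actId_cell {A C : B} (x : F.obj A) {u v : A ⟶ C} (γ : u ⟶ v) :
    L.homMk (⟨𝟙 C, v, (actId F (act F u x)).hom ≫ cell F γ x⟩ :
        Premorphism (⟨C, act F u x⟩ : L F) ⟨A, x⟩) =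
      L.homMk ⟨𝟙 C, u, (actId F (act F u x)).hom⟩ := by
  -- F2 compares `γ` with the identity of `u`, both read as 2-cells over the span `u`, `𝟙 A`.
  -- Stripped of unitors, its equation says that `γ ▷ w₁` followed by the invertible `α` is the
  -- whiskering of an invertible `β'`. After pushing along `w₁` and `w₂`, the two premorphisms are
  -- thus related by invertible 2-cells.
  obtain ⟨D, w₁, w₂, α, β, h⟩ := IsPreTwoFiltered.exists_ll u (𝟙 A) (𝟙 C) v
    ((ρ_ u).hom ≫ γ ≫ (λ_ v).inv) (𝟙 C) u ((ρ_ u).hom ≫ (λ_ u).inv)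
  let β' : w₁ ≅ w₂ := (λ_ w₁).symm ≪≫ β ≪≫ λ_ w₂
  have h' : γ ▷ w₁ ≫ α.hom = u ◁ β'.hom := by
    have h₂ := u ◁ (λ_ w₁).inv ≫= (h =≫ (λ_ (u ≫ w₂)).hom)
    simp at h₂
    simpa [β'] using h₂
  rw [L.homMk_push _ w₁, L.homMk_push _ w₂]
  refine L.homMk_eq_of_sq β α ?_
  have h₁ := Sq.hcomp (Sq.nat (actId F (act F u x)).hom β'.hom)
    (Sq.cell (F := F) (x := x) (γ' := 𝟙 (u ≫ w₂)) (h'.trans (Category.comp_id _).symm))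
  rw [← push_cell, ← push_comp, cell_id, Category.comp_id] at h₁
  simpa [β'] using h₁

/-! ### The pseudocone `λ` -/

/-- The morphism `λ_A(ξ)`. -/
def L.inclMap {A : B} {x y : F.obj A} (ξ : x ⟶ y) : (⟨A, x⟩ : L F) ⟶ ⟨A, y⟩ :=
  L.homMk ⟨𝟙 A, 𝟙 A, actMap F (𝟙 A) ξ⟩

variable (F) in
/-- The functor `λ_A : F(A) ⥤ L(F)`. -/
noncomputable def L.incl (A : B) : F.obj A ⥤ L F where
  obj x := ⟨A, x⟩
  map ξ := L.inclMap ξ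
  map_id x := by
    refine Eq.trans ?_ (L.homMk_id (X := ⟨A, x⟩) (𝟙 A))
    simp [L.inclMap, actMap]
  map_comp {x y z} ξ ζ := by
    refine Eq.trans ?_ (L.homMk_comp_of_apex (X := ⟨A, x⟩) (Y := ⟨A, y⟩) (Z := ⟨A, z⟩)
      (actMap F (𝟙 A) ξ) (actMap F (𝟙 A) ζ)).symm
    simp [L.inclMap, actMap]

/-- The isomorphism `(λ_u)_x : (F(u)(x), C) ≅ (x, A)`. -/
noncomputable def L.actIso {A C : B} (u : A ⟶ C) (x : F.obj A) :
    (⟨C, act F u x⟩ : L F) ≅ ⟨A, x⟩ where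
  hom := L.homMk ⟨𝟙 C, u, (actId F (act F u x)).hom⟩
  inv := L.homMk ⟨u, 𝟙 C, (actId F (act F u x)).inv⟩
  hom_inv_id := by
    rw [L.homMk_comp_of_apex, Iso.hom_inv_id]
    exact L.homMk_id (X := ⟨C, act F u x⟩) _
  inv_hom_id := by
    rw [L.homMk_comp_of_apex, Iso.inv_hom_id]
    exact L.homMk_id (X := ⟨A, x⟩) _

lemma L.inclMap_comp_actIso {A C : B} (u : A ⟶ C) {y : F.obj C} {x : F.obj A}
    (ξ : y ⟶ act F u x) :
    L.inclMap ξ ≫ (L.actIso u x).hom = L.homMk ⟨𝟙 C, u, (actId F y).hom ≫ ξ⟩ := by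
  rw [← actMap_id_naturality]
  exact L.homMk_comp_of_apex _ _

/-- A morphism of `L(F)` is the composite `λ_v ∘ λ_C(ξ) ∘ λ_u⁻¹`. -/
lemma L.homMk_factor {X Y : L F} (p : Premorphism X Y) :
    L.homMk p = (L.actIso p.u X.pt).inv ≫ L.inclMap p.ξ ≫ (L.actIso p.v Y.pt).hom := by
  rw [L.inclMap_comp_actIso]
  refine Eq.trans ?_ (L.homMk_comp_of_apex _ _).symm
  rw [Iso.inv_hom_id_assoc]

lemma L.inclMap_actId {A : B} (x : F.obj A) :
    L.inclMap (actId F x).hom = (L.actIso (𝟙 A) x).hom := by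
  rw [L.inclMap, actMap_actId]
  rfl

lemma L.actIso_naturality {A C : B} (u : A ⟶ C) {x y : F.obj A} (ξ : x ⟶ y) :
    L.inclMap (actMap F u ξ) ≫ (L.actIso u y).hom = (L.actIso u x).hom ≫ L.inclMap ξ := by
  rw [L.inclMap_comp_actIso, L.inclMap, L.homMk_actMap ξ u]
  exact (L.homMk_comp_of_apex (X := ⟨C, act F u x⟩) (Y := ⟨A, x⟩) (Z := ⟨A, y⟩)
    (actId F (act F u x)).hom (actMap F u ξ)).symm

lemma L.actIso_comp {A C D : B} (u : A ⟶ C) (v : C ⟶ D) (x : F.obj A) :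
    L.inclMap (actComp F u v x).hom ≫ (L.actIso v (act F u x)).hom ≫ (L.actIso u x).hom =
      (L.actIso (u ≫ v) x).hom := by
  rw [← Category.assoc, L.inclMap_comp_actIso]
  change _ ≫ L.homMk _ = L.homMk _
  rw [L.homMk_actId x u v]
  refine (L.homMk_comp_of_apex (X := ⟨D, act F (u ≫ v) x⟩) (Y := ⟨C, act F u x⟩) (Z := ⟨A, x⟩)
    ((actId F (act F (u ≫ v) x)).hom ≫ (actComp F u v x).hom) (actComp F u v x).inv).trans ?_
  rw [Category.assoc, Iso.hom_inv_id, Category.comp_id]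

lemma L.inclMap_cell {A C : B} {u v : A ⟶ C} (γ : u ⟶ v) (x : F.obj A) :
    L.inclMap (cell F γ x) ≫ (L.actIso v x).hom = (L.actIso u x).hom :=
  (L.inclMap_comp_actIso _ _).trans (L.homMk_actId_cell x γ)

variable (F) in
/-- The pseudocone `λ` with vertex `L(F)`. -/
noncomputable def Pseudocone.lam : Pseudocone F (L F) where
  app := L.incl F
  trans u := NatIso.ofComponents (L.actIso u) (L.actIso_naturality u)
  trans_id x := (L.inclMap_actId x).symm
  trans_comp u v x := (L.actIso_comp u v x).symm
  trans_cell γ x := L.inclMap_cell γ x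

end

/-! ### Values of a pseudocone on premorphisms -/

section

variable {B : Type u₁} [Bicategory.{w₁, v₁} B] {F : B ⥤ᵖ Cat.{v₂, u₂}}
  {𝒳 : Type u₃} [Category.{v₃} 𝒳]

namespace Pseudocone

lemma _root_.CategoryTheory.eq_eqToHom_comp {C : Type u₃} [Category.{v₃} C] {X Y : C} (p : X = X)
    (q : Y = Y) (f : X ⟶ Y) : f = eqToHom p ≫ f ≫ eqToHom q := by
  simp

/-- Pseudocones are equal when their functors and their natural isomorphisms are. -/
lemma ext_of_app {h l : Pseudocone F 𝒳} (happ : ∀ A, h.app A = l.app A)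
    (htrans : ∀ {A C : B} (u : A ⟶ C) (x : F.obj A), (h.trans u).hom.app x =
      eqToHom (Functor.congr_obj (happ C) _) ≫ (l.trans u).hom.app x ≫
        eqToHom (Functor.congr_obj (happ A) x).symm) : h = l := by
  obtain ⟨ha, ht, _, _, _⟩ := h
  obtain ⟨la, lt, _, _, _⟩ := l
  obtain rfl : ha = la := funext happ
  congr
  funext A C u
  ext x
  simpa using htrans u x

/-- The value `h_v ∘ h_C(ξ) ∘ h_u⁻¹` of a pseudocone `h` on a premorphism `(u, ξ, v)`. -/
def val (h : Pseudocone F 𝒳) {A A' C : B} {u : A ⟶ C} {v : A' ⟶ C} {x : F.obj A} {y : F.obj A'}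
    (ξ : act F u x ⟶ act F v y) : (h.app A).obj x ⟶ (h.app A').obj y :=
  (h.trans u).inv.app x ≫ (h.app C).map ξ ≫ (h.trans v).hom.app y

section val

variable (h : Pseudocone F 𝒳) {A A' A'' C D : B} {x : F.obj A} {y : F.obj A'} {z : F.obj A''}
  {u u' : A ⟶ C} {v v' : A' ⟶ C} {k : A'' ⟶ C}

lemma val_comp (ξ : act F u x ⟶ act F v y) (ζ : act F v y ⟶ act F k z) :
    h.val (ξ ≫ ζ) = h.val ξ ≫ h.val ζ := by
  simp [val]

lemma val_cell (γ : u ⟶ u') : h.val (cell F γ x) = 𝟙 _ := by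
  rw [val, h.trans_cell]
  exact (h.trans u).inv_hom_id_app x

lemma val_id : h.val (𝟙 (act F u x)) = 𝟙 _ := by
  rw [← cell_id, val_cell]

/-- PC1 for each leg splits off `h_w` (`hu`, `hv`); naturality of `h_w` at `ξ` then moves it from
one side to the other, where it cancels. -/
lemma val_push (ξ : act F u x ⟶ act F v y) (w : C ⟶ D) : h.val (push F ξ w) = h.val ξ := by
  have nat : (h.app D).map (actMap F w ξ) ≫ (h.trans w).hom.app (act F v y) =
      (h.trans w).hom.app (act F u x) ≫ (h.app C).map ξ := (h.trans w).hom.naturality ξ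
  have hpush : (h.app D).map (push F ξ w) = (h.app D).map (actComp F u w x).hom ≫
      (h.app D).map (actMap F w ξ) ≫ (h.app D).map (actComp F v w y).inv := by
    rw [push, Functor.map_comp, Functor.map_comp]
  have hv : (h.app D).map (actComp F v w y).inv ≫ (h.trans (v ≫ w)).hom.app y =
      (h.trans w).hom.app (act F v y) ≫ (h.trans v).hom.app y := by
    rw [h.trans_comp, ← Functor.map_comp_assoc, Iso.inv_hom_id, CategoryTheory.Functor.map_id, Category.id_comp]
  have hu : (h.trans (u ≫ w)).hom.app x ≫ (h.trans u).inv.app x =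
      (h.app D).map (actComp F u w x).hom ≫ (h.trans w).hom.app (act F u x) := by
    rw [h.trans_comp, Category.assoc, Category.assoc, Iso.hom_inv_id_app]
    exact congrArg _ (Category.comp_id _)
  rw [val, val, ← cancel_epi ((h.trans (u ≫ w)).hom.app x), Iso.hom_inv_id_app_assoc,
    reassoc_of% hu, hpush, Category.assoc, Category.assoc, hv, reassoc_of% nat]

/-- Evaluating the square turns its vertical sides into identities, by PC2. Invertibility of the
2-cells plays no role. -/
lemma val_eq_of_sq {ξ : act F u x ⟶ act F v y} {ξ' : act F u' x ⟶ act F v' y} {β : u ⟶ u'}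
    {α : v ⟶ v'} (H : Sq ξ ξ' β α) : h.val ξ = h.val ξ' := by
  have := congrArg h.val H
  simpa [val_comp, val_cell] using this

end val

lemma val_eq_of_homotopic (h : Pseudocone F 𝒳) {X Y : L F} {p q : Premorphism X Y}
    (H : Homotopic p q) : h.val p.ξ = h.val q.ξ := by
  obtain ⟨H⟩ := H
  rw [← h.val_push p.ξ H.w₁, ← h.val_push q.ξ H.w₂]
  exact h.val_eq_of_sq H.ll

/-! ### The universal property -/

variable [IsPreTwoFiltered B]

/-- The functor `L(F) ⥤ 𝒳` induced by a pseudocone. -/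
noncomputable def desc (h : Pseudocone F 𝒳) : L F ⥤ 𝒳 where
  obj X := (h.app X.base).obj X.pt
  map := Quotient.lift (fun p => h.val p.ξ) fun _ _ H => h.val_eq_of_homotopic H
  map_id _ := h.val_id
  map_comp := by
    rintro X Y Z ⟨p⟩ ⟨q⟩
    change h.val (push F p.ξ _ ≫ cell F _ Y.pt ≫ push F q.ξ _) = h.val p.ξ ≫ h.val q.ξ
    refine (h.val_comp _ _).trans (congrArg₂ _ (h.val_push p.ξ _) ?_)
    refine (h.val_comp _ _).trans ((congrArg₂ _ (h.val_cell _) (h.val_push q.ξ _)).trans ?_)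
    exact Category.id_comp _

lemma postcomp_obj_desc (h : Pseudocone F 𝒳) : ((lam F).postcomp 𝒳).obj h.desc = h := by
  have happ (A : B) : L.incl F A ⋙ h.desc = h.app A := by
    -- The objects agree definitionally, so the transports are identities. On morphisms, naturality
    -- of `h_id` removes the conjugation by it.
    refine CategoryTheory.Functor.ext (fun _ => rfl) fun x y ξ => ?_
    refine Eq.trans ?_ (eq_eqToHom_comp _ _ _)
    change (h.trans (𝟙 A)).inv.app x ≫ ((F.map (𝟙 A)).toFunctor ⋙ h.app A).map ξ ≫
      (h.trans (𝟙 A)).hom.app y = _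
    rw [NatTrans.naturality, Iso.inv_hom_id_app_assoc]
  refine ext_of_app happ fun {A C} u x => ?_
  refine Eq.trans ?_ (eq_eqToHom_comp _ _ _)
  change h.val (actId F (act F u x)).hom = (h.trans u).hom.app x
  -- PC0 turns the middle factor into `h_id`, which cancels against the leading inverse.
  rw [val, ← h.trans_id]
  simp

lemma desc_postcomp_obj (s : L F ⥤ 𝒳) : (((lam F).postcomp 𝒳).obj s).desc = s := by
  refine CategoryTheory.Functor.ext (fun _ => rfl) ?_
  rintro X Y ⟨p⟩
  refine Eq.trans ?_ (eq_eqToHom_comp _ _ _)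
  change _ = s.map (L.homMk p)
  rw [L.homMk_factor, s.map_comp, s.map_comp]
  -- The image under `s` of the factorization is, by definition, the value of the pseudocone `s λ`
  -- on `p`.
  rfl

lemma postcomp_obj_bijective :
    Function.Bijective ((lam F).postcomp 𝒳).obj :=
  Function.bijective_iff_has_inverse.2 ⟨desc, desc_postcomp_obj, postcomp_obj_desc⟩

/-- Each object of `L(F)` is some `λ_A(x)`, so the whiskered family already contains every
component. -/
instance : ((lam F).postcomp 𝒳).Faithful where
  map_injective {s t σ τ} H := by
    ext X
    exact congrArg (fun φ : Hom _ _ => (φ.app X.base).app X.pt) H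

instance : ((lam F).postcomp 𝒳).Full where
  map_surjective {s t} φ := by
    let σ (X : L F) : s.obj X ⟶ t.obj X := (Hom.app φ X.base).app X.pt
    have trans {A C : B} (u : A ⟶ C) (x : F.obj A) : s.map (L.actIso u x).hom ≫ σ ⟨A, x⟩ =
        σ ⟨C, act F u x⟩ ≫ t.map (L.actIso u x).hom := Hom.naturality φ u x
    have incl {A : B} {x y : F.obj A} (ξ : x ⟶ y) : s.map (L.inclMap ξ) ≫ σ ⟨A, y⟩ =
        σ ⟨A, x⟩ ≫ t.map (L.inclMap ξ) := (Hom.app φ A).naturality ξ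
    refine ⟨{ app := σ, naturality := ?_ }, rfl⟩
    rintro X Y ⟨p⟩
    change s.map (L.homMk p) ≫ σ Y = σ X ≫ t.map (L.homMk p)
    -- PCM gives naturality of `σ` at `λ_u`; the factorization of `p` also needs it at the inverse.
    have hu : s.map (L.actIso p.u X.pt).inv ≫ σ ⟨_, act F p.u X.pt⟩ =
        σ X ≫ t.map (L.actIso p.u X.pt).inv := by
      rw [← cancel_epi (s.map (L.actIso p.u X.pt).hom), ← Category.assoc, ← Category.assoc,
        trans, ← s.map_comp, Category.assoc, ← t.map_comp, Iso.hom_inv_id]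
      simp
    rw [L.homMk_factor]
    simp only [Functor.map_comp, Category.assoc]
    rw [trans p.v Y.pt, reassoc_of% incl p.ξ, reassoc_of% hu]

end Pseudocone

end

/-- A fully faithful functor that is bijective on objects is an isomorphism of categories. -/
lemma IsIsoOfCategories.of_bijective {C : Type u₃} [Category.{v₃} C] {D : Type u₄}
    [Category.{v₄} D] (Φ : C ⥤ D) [Φ.Full] [Φ.Faithful] (hΦ : Function.Bijective Φ.obj) :
    IsIsoOfCategories Φ := by
  obtain ⟨g, hg, hg'⟩ := Function.bijective_iff_has_inverse.1 hΦ
  let Ψ : D ⥤ C :=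
    { obj := g
      map := fun f => Φ.preimage (eqToHom (hg' _) ≫ f ≫ eqToHom (hg' _).symm)
      map_id := fun X => Φ.map_injective (by simp)
      map_comp := fun f f' => Φ.map_injective (by simp) }
  refine ⟨Ψ, CategoryTheory.Functor.ext hg fun X Y f => Φ.map_injective ?_, CategoryTheory.Functor.ext hg' fun X Y f => ?_⟩
  · simp [Ψ, eqToHom_map]
  · simp [Ψ]

end LL

theorem mainTheorem1 {B : Type u₁} [Bicategory.{w₁, v₁} B] [Bicategory.Strict B]
    [IsPreTwoFiltered B] (F : StrictPseudofunctor B Cat.{v₂, u₂}) :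
    ∃ lam : LL.Pseudocone F.toPseudofunctor (LL.L F.toPseudofunctor),
      (∃ hobj : ∀ (A : B) (x : F.obj A), (lam.app A).obj x = ⟨A, x⟩,
        (∀ (A : B) (x y : F.obj A) (ξ : x ⟶ y),
          (lam.app A).map ξ =
            eqToHom (hobj A x) ≫
              LL.L.homMk ⟨𝟙 A, 𝟙 A, LL.actMap F.toPseudofunctor (𝟙 A) ξ⟩ ≫
              eqToHom (hobj A y).symm) ∧
        (∀ (A C : B) (u : A ⟶ C) (x : F.obj A),
          (lam.trans u).hom.app x =
            eqToHom (hobj C (LL.act F.toPseudofunctor u x)) ≫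
              LL.L.homMk ⟨𝟙 C, u, (LL.actId F.toPseudofunctor
                (LL.act F.toPseudofunctor u x)).hom⟩ ≫
              eqToHom (hobj A x).symm)) ∧
      ∀ (𝒳 : Type u₃) [Category.{v₃} 𝒳],
        (lam.postcomp 𝒳).IsEquivalence ∧
        LL.IsIsoOfCategories (lam.postcomp 𝒳) ∧
        ∀ h : LL.Pseudocone F.toPseudofunctor 𝒳,
          ∃! s : LL.L F.toPseudofunctor ⥤ 𝒳, (lam.postcomp 𝒳).obj s = h := by
  refine ⟨LL.Pseudocone.lam F.toPseudofunctor, ⟨fun _ _ => rfl, ?_, ?_⟩, fun 𝒳 _ => ?_⟩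
  · intro A x y ξ
    exact eq_eqToHom_comp _ _ _
  · intro A C u x
    exact eq_eqToHom_comp _ _ _
  · have hbij := LL.Pseudocone.postcomp_obj_bijective (F := F.toPseudofunctor) (𝒳 := 𝒳)
    refine ⟨{ essSurj := ⟨fun h => ?_⟩ }, LL.IsIsoOfCategories.of_bijective _ hbij,
      hbij.existsUnique⟩
    obtain ⟨s, rfl⟩ := hbij.2 h
    exact ⟨s, ⟨Iso.refl _⟩⟩
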